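/- A path on the rectangular grid (grid points $\mathbb Z\times\mathbb Z$, grid edges between points at distance $1$) is called an $\llcorner$-path if it has at least one edge and consists of a vertical segment going up and a horizontal segment going right from a common grid point, where one of the two segments may be degenerate (so nontrivial horizontal and vertical segments are allowed). A graph $G$ is $\llcorner$-EPG if there is a family $(P_v)_{v\in V(G)}$ of $\llcorner$-paths on the grid such that two distinct vertices $u,v$ of $G$ are adjacent if and only if $P_u$ and $P_v$ share at least one grid edge. A block of $G$ is a maximal subgraph of $G$ that is connected and has no cut vertex of its own; a cut vertex is a vertex whose deletion disconnects the connected component containing it. Theorem 2. Let $G$ be a finite graph such that every block of $G$ is $\llcorner$-EPG and every cut vertex $v$ of $G$ is adjacent to all other vertices of each block of $G$ that contains $v$. Then $G$ is $\llcorner$-EPG. -/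

import Mathlib

namespace EPG

/-- The rectangular grid: grid points are the points of `ℤ × ℤ`, and grid edges join points at
distance one in the same row or in the same column. -/
def grid : SimpleGraph (ℤ × ℤ) where
  Adj p q := (p.1 = q.1 ∧ |p.2 - q.2| = 1) ∨ (p.2 = q.2 ∧ |p.1 - q.1| = 1)
  symm := ⟨by
    rintro p q (⟨h, k⟩ | ⟨h, k⟩)
    · exact Or.inl ⟨h.symm, by rwa [abs_sub_comm]⟩
    · exact Or.inr ⟨h.symm, by rwa [abs_sub_comm]⟩⟩
  loopless := ⟨by
    rintro p (⟨_, k⟩ | ⟨_, k⟩) <;> simp at k⟩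

/-- A nontrivial path on the grid. -/
structure GridPath where
  start : ℤ × ℤ
  finish : ℤ × ℤ
  walk : grid.Walk start finish
  isPath : walk.IsPath
  nontrivial : 0 < walk.length

/-- The set of grid edges of a path on the grid. -/
def GridPath.edgeSet (P : GridPath) : Set (Sym2 (ℤ × ℤ)) := {e | e ∈ P.walk.edges}

/-- The edges of the vertical segment with `h` edges that goes up from the point `(x, y)`. -/
def upArm (x y : ℤ) (h : ℕ) : Set (Sym2 (ℤ × ℤ)) :=
  {e | ∃ i : ℕ, i < h ∧ e = s((x, y + i), (x, y + i + 1))}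

/-- The edges of the horizontal segment with `w` edges that goes right from the point `(x, y)`. -/
def rightArm (x y : ℤ) (w : ℕ) : Set (Sym2 (ℤ × ℤ)) :=
  {e | ∃ i : ℕ, i < w ∧ e = s((x + i, y), (x + i + 1, y))}

/-- The path is `⌞`-shaped or straight: it consists of a vertical segment going up and a horizontal
segment going right from a common grid point. One of the two segments may be degenerate, and then
the path is a horizontal or vertical segment. -/
def GridPath.IsLShaped (P : GridPath) : Prop :=
  ∃ (x y : ℤ) (h w : ℕ), P.edgeSet = upArm x y h ∪ rightArm x y w

/-- The edge intersection graph of a family of paths on the grid (two members of the family may be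
the same path): distinct members are adjacent iff they share at least one grid edge. -/
def intersectionGraph {V : Type*} (P : V → GridPath) : SimpleGraph V where
  Adj u v := u ≠ v ∧ ((P u).edgeSet ∩ (P v).edgeSet).Nonempty
  symm := ⟨fun _ _ h => ⟨h.1.symm, by rw [Set.inter_comm]; exact h.2⟩⟩
  loopless := ⟨fun _ h => h.1 rfl⟩

/-- `G` is `⌞`-EPG: it is the edge intersection graph of a family of paths on the grid, each of
which is `⌞`-shaped or straight. -/
def IsLEPG {V : Type*} (G : SimpleGraph V) : Prop :=
  ∃ P : V → GridPath, (∀ v, (P v).IsLShaped) ∧ G = intersectionGraph P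

/-- `v` is a cut vertex of `G`: deleting `v` separates two vertices of one connected component
of `G`. For a connected graph `G` this says that `G - v` is disconnected. -/
def IsCutVertex {V : Type*} (G : SimpleGraph V) (v : V) : Prop :=
  ∃ (a b : V) (ha : a ≠ v) (hb : b ≠ v), G.Reachable a b ∧
    ¬ (G.induce {u | u ≠ v}).Reachable ⟨a, ha⟩ ⟨b, hb⟩

/-- A graph is biconnected if it is connected and has no cut vertex (so `K₁` and `K₂` are
biconnected). -/
def IsBiconnected {V : Type*} (G : SimpleGraph V) : Prop :=
  G.Connected ∧ ∀ v, ¬ IsCutVertex G v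

/-- A block of `G` is a maximal biconnected subgraph of `G`. -/
def IsBlock {V : Type*} (G : SimpleGraph V) (B : G.Subgraph) : Prop :=
  Maximal (fun H : G.Subgraph => IsBiconnected H.coe) B

/-- A universal vertex of `G` is adjacent to all other vertices of `G`. -/
def IsUniversal {V : Type*} (G : SimpleGraph V) (v : V) : Prop :=
  ∀ w, w ≠ v → G.Adj v w

end EPG

/-!
In an intersection graph of `⌞`-shapes, the neighbourhood of a universal vertex `p` is an interval
graph: a shape that overlaps only one arm of `p` meets the other shapes of this kind on that arm
alone, and a shape that overlaps both arms has its corner at the corner of `p`, so that the two arms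
of `p` can be unfolded to a line (`HasLRep.exists_intervals`).

Components can be drawn far apart (`hasLRep_of_components`), and a component without a cut vertex is
a block. So let `G` be connected and `r` a cut vertex of `G`. Distances from `r` turn `G` into a
tree of interval graphs. In a block `S`, the vertex `c` nearest to `r` separates the rest of `S`
from `r`, since otherwise `S` could be enlarged by an ear (`not_joinedIn_of_nearest`); hence `c` is
a cut vertex and is adjacent to the rest of `S`. It follows that every `v ≠ r` has exactly one
neighbour nearer to `r`, its parent, and that adjacent vertices at the same distance from `r` have
the same parent (`IsBlockwiseLRep.parent_unique`). A connected set of children of `p` forms a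
biconnected set with `p`, so it induces an interval graph. A vertex that has children itself is a
cut vertex, hence adjacent to all of its connected set of siblings, so its interval may be extended
to the left in order to begin at a point where no other interval begins
(`IsBlockwiseLRep.exists_positions`).

Such a tree of interval graphs is drawn as follows (`hasLRep_of_layout`). Every vertex `p` with
children owns a grid line that carries the intervals of its children; the shape of a child `v`
covers its interval there and, if `v` has children, turns at the beginning of the interval into the
perpendicular line that `v` owns. Positions increase with the distance from `r`, which leaves the
room to draw all arms upwards and to the right, and the lines of different vertices are different.
-/

namespace EPG

/-! ### Coordinates for families of `⌞`-shaped paths -/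

/-- The half-open integer intervals `[a, b)` and `[a', b')` share a unit edge. -/
def Overlap (a b a' b' : ℤ) : Prop := a < b ∧ a < b' ∧ a' < b ∧ a' < b'

/-- `G` is the intersection graph of the `⌞`-shapes with corner `(x v, y v)`, vertical arm of
length `h v` and horizontal arm of length `w v`. Only collinear arms can share an edge, so adjacency
is a statement about overlapping intervals in a common column or in a common row. -/
structure IsLRep {V : Type*} (G : SimpleGraph V) (x y h w : V → ℤ) : Prop where
  up_nonneg : ∀ v, 0 ≤ h v
  right_nonneg : ∀ v, 0 ≤ w v
  nontrivial : ∀ v, 0 < h v + w v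
  adj_iff : ∀ u v, G.Adj u v ↔ u ≠ v ∧
    ((x u = x v ∧ Overlap (y u) (y u + h u) (y v) (y v + h v)) ∨
      (y u = y v ∧ Overlap (x u) (x u + w u) (x v) (x v + w v)))

/-- `G` has a coordinate description by `⌞`-shapes. -/
def HasLRep {V : Type*} (G : SimpleGraph V) : Prop :=
  ∃ x y h w : V → ℤ, IsLRep G x y h w

theorem mk_up_mem_upArm (x y a b : ℤ) (h : ℕ) :
    s((a, b), (a, b + 1)) ∈ upArm x y h ↔ a = x ∧ y ≤ b ∧ b < y + h := by
  constructor
  · rintro ⟨i, hi, he⟩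
    simp only [Sym2.eq_iff, Prod.mk.injEq] at he
    omega
  · rintro ⟨rfl, h1, h2⟩
    refine ⟨(b - y).toNat, by omega, ?_⟩
    rw [show y + ((b - y).toNat : ℤ) = b by omega]

theorem mk_right_mem_rightArm (x y a b : ℤ) (w : ℕ) :
    s((a, b), (a + 1, b)) ∈ rightArm x y w ↔ b = y ∧ x ≤ a ∧ a < x + w := by
  constructor
  · rintro ⟨i, hi, he⟩
    simp only [Sym2.eq_iff, Prod.mk.injEq] at he
    omega
  · rintro ⟨rfl, h1, h2⟩
    refine ⟨(a - x).toNat, by omega, ?_⟩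
    rw [show x + ((a - x).toNat : ℤ) = a by omega]

theorem mk_up_notMem_rightArm (x y a b : ℤ) (w : ℕ) :
    s((a, b), (a, b + 1)) ∉ rightArm x y w := by
  rintro ⟨i, hi, he⟩
  simp only [Sym2.eq_iff, Prod.mk.injEq] at he
  omega

theorem mk_right_notMem_upArm (x y a b : ℤ) (h : ℕ) :
    s((a, b), (a + 1, b)) ∉ upArm x y h := by
  rintro ⟨i, hi, he⟩
  simp only [Sym2.eq_iff, Prod.mk.injEq] at he
  omega

theorem inter_arms_nonempty_iff (x y x' y' : ℤ) (h w h' w' : ℕ) :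
    ((upArm x y h ∪ rightArm x y w) ∩ (upArm x' y' h' ∪ rightArm x' y' w')).Nonempty ↔
      ((x = x' ∧ Overlap y (y + h) y' (y' + h')) ∨
        (y = y' ∧ Overlap x (x + w) x' (x' + w'))) := by
  constructor
  · rintro ⟨e, ⟨i, hi, rfl⟩ | ⟨i, hi, rfl⟩, he⟩
    · rw [Set.mem_union, mk_up_mem_upArm] at he
      have := he.resolve_right (mk_up_notMem_rightArm _ _ _ _ _)
      left; unfold Overlap; omega
    · rw [Set.mem_union, mk_right_mem_rightArm] at he
      have := he.resolve_left (mk_right_notMem_upArm _ _ _ _ _)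
      right; unfold Overlap; omega
  · rintro (⟨h1, h2⟩ | ⟨h1, h2⟩)
    · refine ⟨s((x, max y y'), (x, max y y' + 1)), Or.inl ?_, Or.inl ?_⟩ <;>
        rw [mk_up_mem_upArm] <;> unfold Overlap at h2 <;> omega
    · refine ⟨s((max x x', y), (max x x' + 1, y)), Or.inr ?_, Or.inr ?_⟩ <;>
        rw [mk_right_mem_rightArm] <;> unfold Overlap at h2 <;> omega

theorem arms_nonempty_iff (x y : ℤ) (h w : ℕ) :
    (upArm x y h ∪ rightArm x y w).Nonempty ↔ 0 < h + w := by
  have := inter_arms_nonempty_iff x y x y h w h w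
  rw [Set.inter_self] at this
  rw [this]
  unfold Overlap
  omega

theorem rightArm_succ (x y : ℤ) (w : ℕ) :
    rightArm x y (w + 1) = insert s((x, y), (x + 1, y)) (rightArm (x + 1) y w) := by
  ext e
  constructor
  · rintro ⟨_ | i, hi, rfl⟩
    · left; simp
    · right
      refine ⟨i, by omega, ?_⟩
      push_cast
      rw [show x + ((i : ℤ) + 1) = x + 1 + i by ring]
  · rintro (rfl | ⟨i, hi, rfl⟩)
    · exact ⟨0, by omega, by simp⟩
    · refine ⟨i + 1, by omega, ?_⟩
      push_cast
      rw [show x + ((i : ℤ) + 1) = x + 1 + i by ring]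

theorem upArm_succ (x y : ℤ) (h : ℕ) :
    upArm x y (h + 1) = insert s((x, y + h), (x, y + h + 1)) (upArm x y h) := by
  ext e
  constructor
  · rintro ⟨i, hi, rfl⟩
    rcases Nat.lt_succ_iff_lt_or_eq.1 hi with hi | rfl
    · exact Or.inr ⟨i, hi, rfl⟩
    · exact Or.inl rfl
  · rintro (rfl | ⟨i, hi, rfl⟩)
    · exact ⟨h, by omega, rfl⟩
    · exact ⟨i, by omega, rfl⟩

theorem exists_right_walk (y : ℤ) (w : ℕ) : ∀ x : ℤ,
    ∃ p : grid.Walk (x, y) (x + w, y), p.IsPath ∧ {e | e ∈ p.edges} = rightArm x y w ∧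
      ∀ q ∈ p.support, q.2 = y ∧ x ≤ q.1 := by
  induction w with
  | zero =>
    intro x
    refine ⟨SimpleGraph.Walk.nil.copy rfl (by simp), by simp, ?_, by simp⟩
    ext e; simp [rightArm]
  | succ w ih =>
    intro x
    obtain ⟨p, hp, he, hs⟩ := ih (x + 1)
    have hadj : grid.Adj (x, y) (x + 1, y) := Or.inr ⟨rfl, by simp⟩
    have hend : ((x + 1 + (w : ℤ), y) : ℤ × ℤ) = (x + ((w + 1 : ℕ) : ℤ), y) := by
      push_cast; rw [add_right_comm, add_assoc]
    refine ⟨(SimpleGraph.Walk.cons hadj p).copy rfl hend, ?_, ?_, ?_⟩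
    · rw [SimpleGraph.Walk.isPath_copy, SimpleGraph.Walk.cons_isPath_iff]
      refine ⟨hp, fun hm => ?_⟩
      have := (hs _ hm).2
      simp at this
    · rw [rightArm_succ, ← he]
      ext e; simp
    · intro q hq
      simp only [SimpleGraph.Walk.support_copy, SimpleGraph.Walk.support_cons,
        List.mem_cons] at hq
      rcases hq with rfl | hq
      · simp
      · have := hs q hq; omega

/-- The walk from the top of the vertical arm to the right end of the horizontal arm. The bound on
the support keeps it a path when the vertical arm is extended at the top. -/
theorem exists_arms_walk (x y : ℤ) (w : ℕ) (h : ℕ) :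
    ∃ p : grid.Walk (x, y + h) (x + w, y), p.IsPath ∧
      {e | e ∈ p.edges} = upArm x y h ∪ rightArm x y w ∧ ∀ q ∈ p.support, q.2 ≤ y + h := by
  induction h with
  | zero =>
    obtain ⟨p, hp, he, hs⟩ := exists_right_walk y w x
    refine ⟨p.copy (by simp) rfl, by simpa using hp, ?_, ?_⟩
    · rw [← he]; ext e; simp [upArm]
    · intro q hq
      rw [SimpleGraph.Walk.support_copy] at hq
      have := hs q hq; simp; omega
  | succ h ih =>
    obtain ⟨p, hp, he, hs⟩ := ih
    have hadj : grid.Adj (x, y + (h + 1 : ℕ)) (x, y + h) := Or.inl ⟨rfl, by simp⟩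
    refine ⟨SimpleGraph.Walk.cons hadj p, ?_, ?_, ?_⟩
    · rw [SimpleGraph.Walk.cons_isPath_iff]
      refine ⟨hp, fun hm => ?_⟩
      have := hs _ hm
      simp at this
    · rw [upArm_succ, Set.insert_union, ← he]
      ext e
      simp [Sym2.eq_swap (a := (x, y + ((h : ℤ) + 1))), add_assoc]
    · intro q hq
      rw [SimpleGraph.Walk.support_cons, List.mem_cons] at hq
      rcases hq with rfl | hq
      · simp
      · have := hs q hq; push_cast; omega

theorem IsLEPG.hasLRep {V : Type*} {G : SimpleGraph V} (hG : IsLEPG G) : HasLRep G := by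
  obtain ⟨P, hP, rfl⟩ := hG
  choose x y h w hP using hP
  refine ⟨x, y, fun v => h v, fun v => w v, fun v => by simp, fun v => by simp, fun v => ?_,
    fun u v => ?_⟩
  · have hne : (P v).edgeSet.Nonempty := by
      have := (P v).nontrivial
      rw [← SimpleGraph.Walk.length_edges] at this
      exact List.exists_mem_of_length_pos this
    rw [hP, arms_nonempty_iff] at hne
    exact_mod_cast hne
  · change _ ∧ _ ↔ _
    rw [hP, hP, inter_arms_nonempty_iff]

theorem HasLRep.isLEPG {V : Type*} {G : SimpleGraph V} (hG : HasLRep G) : IsLEPG G := by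
  obtain ⟨x, y, h, w, hR⟩ := hG
  have key : ∀ v, ∃ P : GridPath,
      P.edgeSet = upArm (x v) (y v) (h v).toNat ∪ rightArm (x v) (y v) (w v).toNat := by
    intro v
    obtain ⟨p, hp, he, -⟩ := exists_arms_walk (x v) (y v) (w v).toNat (h v).toNat
    have h1 := hR.nontrivial v
    have hne := (arms_nonempty_iff (x v) (y v) (h v).toNat (w v).toNat).2 (by omega)
    rw [← he] at hne
    obtain ⟨e, hm⟩ := hne
    refine ⟨⟨_, _, p, hp, ?_⟩, he⟩
    rw [← SimpleGraph.Walk.length_edges]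
    exact List.length_pos_of_mem hm
  choose P hP using key
  refine ⟨P, fun v => ⟨_, _, _, _, hP v⟩, ?_⟩
  ext u v
  change _ ↔ _ ∧ _
  rw [hP, hP, inter_arms_nonempty_iff, hR.adj_iff, Int.toNat_of_nonneg (hR.up_nonneg u),
    Int.toNat_of_nonneg (hR.up_nonneg v), Int.toNat_of_nonneg (hR.right_nonneg u),
    Int.toNat_of_nonneg (hR.right_nonneg v)]

theorem HasLRep.comap {V W : Type*} {G : SimpleGraph V} {H : SimpleGraph W} (hG : HasLRep G)
    (f : H ↪g G) : HasLRep H := by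
  obtain ⟨x, y, h, w, hR⟩ := hG
  refine ⟨x ∘ f, y ∘ f, h ∘ f, w ∘ f, fun v => hR.up_nonneg _, fun v => hR.right_nonneg _,
    fun v => hR.nontrivial _, fun u v => ?_⟩
  rw [← f.map_adj_iff, hR.adj_iff, f.injective.ne_iff]
  rfl

/-- A representation of an induced subgraph, with the coordinates extended to all vertices. -/
theorem HasLRep.exists_extension {V : Type*} {G : SimpleGraph V} {S : Set V}
    (hG : HasLRep (G.induce S)) : ∃ x y h w : V → ℤ,
      (∀ v ∈ S, 0 ≤ h v ∧ 0 ≤ w v ∧ 0 < h v + w v) ∧ ∀ u ∈ S, ∀ v ∈ S, (G.Adj u v ↔ u ≠ v ∧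
        ((x u = x v ∧ Overlap (y u) (y u + h u) (y v) (y v + h v)) ∨
          (y u = y v ∧ Overlap (x u) (x u + w u) (x v) (x v + w v)))) := by
  classical
  obtain ⟨x, y, h, w, hR⟩ := hG
  refine ⟨fun v => if hv : v ∈ S then x ⟨v, hv⟩ else 0,
    fun v => if hv : v ∈ S then y ⟨v, hv⟩ else 0, fun v => if hv : v ∈ S then h ⟨v, hv⟩ else 0,
    fun v => if hv : v ∈ S then w ⟨v, hv⟩ else 0, fun v hv => ?_, fun u hu v hv => ?_⟩
  · simp only [hv, dif_pos]
    exact ⟨hR.up_nonneg _, hR.right_nonneg _, hR.nontrivial _⟩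
  · have := hR.adj_iff ⟨u, hu⟩ ⟨v, hv⟩
    simp only [SimpleGraph.comap_adj, Function.Embedding.subtype_apply, ne_eq,
      Subtype.mk.injEq] at this
    simp only [hu, hv, dif_pos]
    exact this

/-- Graphs all of whose components have a representation have one: the representations of the
components are translated along the diagonal into disjoint squares. -/
theorem hasLRep_of_components {V : Type*} [Finite V] (G : SimpleGraph V)
    (hG : ∀ c : G.ConnectedComponent, HasLRep (G.induce c.supp)) : HasLRep G := by
  classical
  choose x y h w hpos hadj using fun c => (hG c).exists_extension
  have : Fintype V := Fintype.ofFinite V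
  obtain ⟨n, ⟨idx⟩⟩ := Finite.exists_equiv_fin G.ConnectedComponent
  let cc : V → G.ConnectedComponent := G.connectedComponentMk
  obtain ⟨N, hN⟩ : ∃ N : ℤ, ∀ v, |x (cc v) v| < N ∧ |y (cc v) v| < N := by
    refine ⟨∑ v, (|x (cc v) v| + |y (cc v) v|) + 1, fun v => ?_⟩
    have := Finset.single_le_sum (f := fun v => |x (cc v) v| + |y (cc v) v|)
      (fun v _ => by positivity) (Finset.mem_univ v)
    have h1 := abs_nonneg (x (cc v) v)
    have h2 := abs_nonneg (y (cc v) v)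
    constructor <;> linarith
  -- Translation by multiples of `2 * N` separates the lines used by different components.
  have sep : ∀ (a b : ℤ) (c d : G.ConnectedComponent), |a| < N → |b| < N →
      a + 2 * N * (idx c : ℕ) = b + 2 * N * (idx d : ℕ) → c = d := by
    intro a b c d ha hb hab
    rw [abs_lt] at ha hb
    apply idx.injective
    apply Fin.ext
    by_contra hne
    rcases Nat.lt_or_gt_of_ne hne with hlt | hlt
    · have : ((idx c : ℕ) : ℤ) + 1 ≤ (idx d : ℕ) := by exact_mod_cast hlt
      nlinarith
    · have : ((idx d : ℕ) : ℤ) + 1 ≤ (idx c : ℕ) := by exact_mod_cast hlt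
      nlinarith
  refine ⟨fun v => x (cc v) v + 2 * N * (idx (cc v) : ℕ),
    fun v => y (cc v) v + 2 * N * (idx (cc v) : ℕ), fun v => h (cc v) v, fun v => w (cc v) v,
    fun v => (hpos _ v rfl).1, fun v => (hpos _ v rfl).2.1, fun v => (hpos _ v rfl).2.2,
    fun u v => ?_⟩
  by_cases huv : cc u = cc v
  · rw [hadj (cc u) u rfl v huv.symm]
    simp only [huv]
    unfold Overlap
    generalize 2 * N * ((idx (cc v) : ℕ) : ℤ) = t
    refine and_congr_right fun _ => ?_
    omega
  · constructor
    · intro hadj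
      exact absurd (SimpleGraph.ConnectedComponent.connectedComponentMk_eq_of_adj hadj) huv
    · rintro ⟨-, ⟨he, -⟩ | ⟨he, -⟩⟩
      · exact absurd (sep _ _ _ _ (hN u).1 (hN v).1 he) huv
      · exact absurd (sep _ _ _ _ (hN u).2 (hN v).2 he) huv

/-- In a graph with an `⌞`-representation, the neighbourhood of a universal vertex `p` induces an
interval graph. A vertex whose shape overlaps only the vertical arm of `p` or only the horizontal
arm of `p` meets the others of its kind only on that arm, and a vertex that overlaps both arms has
its corner at the corner of `p`. So the two arms of `p` unfold to a line. -/
theorem HasLRep.exists_intervals {V : Type*} {G : SimpleGraph V} (hG : HasLRep G) (p : V)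
    (hp : IsUniversal G p) :
    ∃ a b : V → ℤ, ∀ u, u ≠ p → a u < b u ∧
      ∀ v, v ≠ p → u ≠ v → (G.Adj u v ↔ Overlap (a u) (b u) (a v) (b v)) := by
  classical
  obtain ⟨x, y, h, w, hR⟩ := hG
  refine ⟨fun v => if x p = x v ∧ Overlap (y p) (y p + h p) (y v) (y v + h v) then
      y p - (y v + h v) else max (x v - x p) 0,
    fun v => if y p = y v ∧ Overlap (x p) (x p + w p) (x v) (x v + w v) then
      x v + w v - x p else - max (y v - y p) 0, fun u hu => ⟨?_, fun v hv huv => ?_⟩⟩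
  · have h1 := ((hR.adj_iff p u).1 (hp u hu)).2
    simp only [Overlap] at *
    split_ifs <;> omega
  · have h1 := (hR.adj_iff p u).1 (hp u hu)
    have h2 := (hR.adj_iff p v).1 (hp v hv)
    have hu1 := hR.up_nonneg u
    have hu2 := hR.right_nonneg u
    have hv1 := hR.up_nonneg v
    have hv2 := hR.right_nonneg v
    have hp1 := hR.up_nonneg p
    have hp2 := hR.right_nonneg p
    rw [hR.adj_iff]
    simp only [ne_eq, huv, not_false_eq_true, true_and]
    have h1 := h1.2
    have h2 := h2.2
    clear hR hp hu hv huv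
    unfold Overlap at *
    generalize x p = px, y p = py, h p = ph, w p = pw at *
    generalize x u = ux, y u = uy, h u = uh, w u = uw at *
    generalize x v = vx, y v = vy, h v = vh, w v = vw at *
    -- For each of `u` and `v`, split by the arms of `p` that it overlaps, at least one
    -- by universality.
    by_cases c1 : px = ux ∧ py < py + ph ∧ py < uy + uh ∧ uy < py + ph ∧ uy < uy + uh <;>
    by_cases c2 : py = uy ∧ px < px + pw ∧ px < ux + uw ∧ ux < px + pw ∧ ux < ux + uw <;>
    by_cases c3 : px = vx ∧ py < py + ph ∧ py < vy + vh ∧ vy < py + ph ∧ vy < vy + vh <;>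
    by_cases c4 : py = vy ∧ px < px + pw ∧ px < vx + vw ∧ vx < px + pw ∧ vx < vx + vw <;>
    (first | rw [if_pos c1] | rw [if_neg c1]) <;> (first | rw [if_pos c2] | rw [if_neg c2]) <;>
    (first | rw [if_pos c3] | rw [if_neg c3]) <;> (first | rw [if_pos c4] | rw [if_neg c4]) <;>
    first
      | (exfalso; clear c3 c4 h2; omega)
      | (exfalso; clear c1 c2 h1; omega)
      | (clear h1 h2; omega)

/-! ### Drawing a rooted tree of interval graphs -/

/-- The drawing of a graph that consists of a tree `par` rooted at `r` and, on the children of each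
vertex, of an intersection graph of intervals `[pos v, top v)`. Every vertex `p` with children owns
a grid line, namely the column (if `p` is even) or the row (if `p` is odd) with coordinate `pos p`.
Each child `v` of `p` gets the interval `[pos v, top v)` on the line of `p`; at its beginning the
shape turns into the line that `v` owns, and covers all intervals on it. By `hinj` no two
vertices of the same parity own the same line, and by `hanc` the intervals of the grandchildren of
`p` lie beyond the line of `p`. -/
theorem hasLRep_of_layout {W : Type*} (G : SimpleGraph W) (r : W) (par : W → W) (Even : W → Prop)
    (pos top : W → ℤ) (N : ℤ) (hpos : ∀ v, 0 ≤ pos v) (hlt : ∀ v, pos v < top v)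
    (hN : ∀ v, top v ≤ N) (hr : Even r) (hpar : ∀ v, v ≠ r → (Even v ↔ ¬ Even (par v)))
    (hanc : ∀ v, v ≠ r → par v ≠ r → pos (par (par v)) < pos v)
    (hinj : ∀ u v, u ≠ r → v ≠ r → (Even (par u) ↔ Even (par v)) → pos (par u) = pos (par v) →
      par u = par v)
    (hadj : ∀ u v, u ≠ v → (G.Adj u v ↔ (u ≠ r ∧ par u = v) ∨ (v ≠ r ∧ par v = u) ∨
      (u ≠ r ∧ v ≠ r ∧ par u = par v ∧ Overlap (pos u) (top u) (pos v) (top v)))) :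
    HasLRep G := by
  classical
  -- `B v` is the coordinate of the line that contains the interval of `v`. The root has no parent,
  -- and its interval lies on the otherwise unused line `-1`.
  obtain ⟨B, hBr, hB⟩ : ∃ B : W → ℤ, B r = -1 ∧ ∀ v, v ≠ r → B v = pos (par v) :=
    ⟨fun v => if v = r then -1 else pos (par v), by simp, fun v hv => by simp [hv]⟩
  obtain ⟨L, hL, hL0⟩ : ∃ L : W → ℤ, (∀ u, u ≠ r → L (par u) = N - B (par u)) ∧
      ∀ v, (∀ u, u ≠ r → par u ≠ v) → L v = 0 := by
    refine ⟨fun v => if ∃ u, u ≠ r ∧ par u = v then N - B v else 0, fun u hu => ?_,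
      fun v hv => ?_⟩
    · exact if_pos ⟨u, hu, rfl⟩
    · refine if_neg ?_
      rintro ⟨u, hu, he⟩
      exact hv u hu he
  have hBN : ∀ v, B v ≤ N := by
    intro v
    by_cases hv : v = r
    · subst hv
      have := hpos v; have := hlt v; have := hN v
      omega
    · have := hlt (par v); have := hN (par v)
      rw [hB v hv]; omega
  have hLnn : ∀ v, 0 ≤ L v := by
    intro v
    by_cases hv : ∃ u, u ≠ r ∧ par u = v
    · obtain ⟨u, hu, rfl⟩ := hv
      have := hBN (par u)
      rw [hL u hu]; omega
    · push Not at hv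
      exact (hL0 v hv).ge
  have hchild : ∀ v, 0 < L v → ∃ u, u ≠ r ∧ par u = v := by
    intro v hv
    by_contra! hcon
    rw [hL0 v hcon] at hv
    omega
  have own_own : ∀ u v, u ≠ v → (Even u ↔ Even v) → ¬ (pos u = pos v ∧
      Overlap (B u) (B u + L u) (B v) (B v + L v)) := by
    rintro u v huv hE ⟨hp, h1, -, -, h2⟩
    obtain ⟨u', hu', rfl⟩ := hchild u (by omega)
    obtain ⟨v', hv', rfl⟩ := hchild v (by omega)
    exact huv (hinj u' v' hu' hv' hE hp)
  have sib_sib : ∀ u v, u ≠ v → (Even u ↔ Even v) → ((B u = B v ∧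
      Overlap (pos u) (pos u + (top u - pos u)) (pos v) (pos v + (top v - pos v))) ↔
      (u ≠ r ∧ v ≠ r ∧ par u = par v ∧ Overlap (pos u) (top u) (pos v) (top v))) := by
    intro u v huv hE
    rw [add_sub_cancel, add_sub_cancel]
    constructor
    · rintro ⟨hb, ho⟩
      by_cases hu : u = r
      · subst hu
        rw [hBr, hB v huv.symm] at hb
        have := hpos (par v)
        omega
      by_cases hv : v = r
      · subst hv
        rw [hBr, hB u huv] at hb
        have := hpos (par u)
        omega
      rw [hB u hu, hB v hv] at hb
      have h1 := hpar u hu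
      have h2 := hpar v hv
      exact ⟨hu, hv, hinj u v hu hv (by tauto) hb, ho⟩
    · rintro ⟨hu, hv, hp, ho⟩
      exact ⟨by rw [hB u hu, hB v hv, hp], ho⟩
  have own_sib : ∀ u v, (Even u ↔ ¬ Even v) → ((pos u = B v ∧
      Overlap (B u) (B u + L u) (pos v) (pos v + (top v - pos v))) ↔ (v ≠ r ∧ par v = u)) := by
    intro u v hE
    rw [add_sub_cancel]
    constructor
    · rintro ⟨hb, h1, -⟩
      by_cases hv : v = r
      · subst hv
        rw [hBr] at hb
        have := hpos u
        omega
      · obtain ⟨u', hu', rfl⟩ := hchild u (by omega)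
        rw [hB v hv] at hb
        have h2 := hpar v hv
        exact ⟨hv, (hinj u' v hu' hv (by tauto) hb).symm⟩
    · rintro ⟨hv, rfl⟩
      refine ⟨(hB v hv).symm, ?_⟩
      have h1 : B (par v) < pos v := by
        by_cases hp : par v = r
        · rw [hp, hBr]; have := hpos v; omega
        · rw [hB _ hp]; exact hanc v hv hp
      have h2 := hlt v
      have h3 := hN v
      rw [hL v hv]
      unfold Overlap
      omega
  refine ⟨fun v => if Even v then pos v else B v, fun v => if Even v then B v else pos v,
    fun v => if Even v then L v else top v - pos v, fun v => if Even v then top v - pos v else L v,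
    fun v => ?_, fun v => ?_, fun v => ?_, fun u v => ?_⟩
  · have := hLnn v; have := hlt v
    split_ifs <;> omega
  · have := hLnn v; have := hlt v
    split_ifs <;> omega
  · have := hLnn v; have := hlt v
    split_ifs <;> omega
  · by_cases huv : u = v
    · simp [huv]
    rw [hadj u v huv]
    have overlap_comm : ∀ a b a' b' : ℤ, Overlap a b a' b' ↔ Overlap a' b' a b := by
      intro a b a' b'
      unfold Overlap
      omega
    -- A child and its parent have different parities, siblings have equal ones.
    have par_ne : (Even u ↔ Even v) → ¬ (u ≠ r ∧ par u = v) ∧ ¬ (v ≠ r ∧ par v = u) := by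
      intro hE
      constructor
      · rintro ⟨hu, rfl⟩
        have := hpar u hu
        tauto
      · rintro ⟨hv, rfl⟩
        have := hpar v hv
        tauto
    have sib_eq : u ≠ r → v ≠ r → par u = par v → (Even u ↔ Even v) := by
      intro hu hv hp
      rw [hpar u hu, hpar v hv, hp]
    have hsib : ¬ (Even u ↔ Even v) → ¬ (u ≠ r ∧ v ≠ r ∧ par u = par v ∧
        Overlap (pos u) (top u) (pos v) (top v)) := fun hE h => hE (sib_eq h.1 h.2.1 h.2.2.1)
    have e4 := own_sib v u
    rw [eq_comm, overlap_comm] at e4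
    by_cases hu : Even u <;> by_cases hv : Even v
    · have hE : Even u ↔ Even v := iff_of_true hu hv
      simp only [if_pos hu, if_pos hv, own_own u v huv hE, sib_sib u v huv hE, par_ne hE, huv,
        false_or, ne_eq, not_false_eq_true, true_and]
    · have hE : ¬ (Even u ↔ Even v) := fun h => hv (h.1 hu)
      simp only [if_pos hu, if_neg hv, own_sib u v (iff_of_true hu hv),
        e4 (iff_of_false hv (not_not.2 hu)), hsib hE, huv,
        or_false, ne_eq, not_false_eq_true, true_and]
      exact or_comm
    · have hE : ¬ (Even u ↔ Even v) := fun h => hu (h.2 hv)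
      simp only [if_neg hu, if_pos hv, own_sib u v (iff_of_false hu (not_not.2 hv)),
        e4 (iff_of_true hv hu), hsib hE, huv,
        or_false, ne_eq, not_false_eq_true, true_and]
    · have hE : Even u ↔ Even v := iff_of_false hu hv
      simp only [if_neg hu, if_neg hv, own_own u v huv hE, sib_sib u v huv hE, par_ne hE, huv,
        false_or, or_false, ne_eq, not_false_eq_true, true_and]

/-! ### Biconnected vertex sets -/

section

variable {V : Type*} {G : SimpleGraph V}

/-- There is a walk of `G` from `a` to `b` all of whose vertices are in `S`. -/
def JoinedIn (G : SimpleGraph V) (S : Set V) (a b : V) : Prop :=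
  ∃ w : G.Walk a b, ∀ x ∈ w.support, x ∈ S

theorem JoinedIn.refl {S : Set V} {a : V} (ha : a ∈ S) : JoinedIn G S a a :=
  ⟨.nil, by simpa using ha⟩

theorem JoinedIn.symm {S : Set V} {a b : V} (h : JoinedIn G S a b) : JoinedIn G S b a := by
  obtain ⟨w, hw⟩ := h
  exact ⟨w.reverse, by simpa using hw⟩

theorem JoinedIn.trans {S : Set V} {a b c : V} (h : JoinedIn G S a b) (h' : JoinedIn G S b c) :
    JoinedIn G S a c := by
  obtain ⟨w, hw⟩ := h
  obtain ⟨w', hw'⟩ := h'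
  refine ⟨w.append w', fun x hx => ?_⟩
  rw [SimpleGraph.Walk.mem_support_append_iff] at hx
  exact hx.elim (hw x) (hw' x)

theorem JoinedIn.mono {S T : Set V} {a b : V} (h : JoinedIn G S a b) (hST : S ⊆ T) :
    JoinedIn G T a b := by
  obtain ⟨w, hw⟩ := h
  exact ⟨w, fun x hx => hST (hw x hx)⟩

theorem JoinedIn.of_adj {S : Set V} {a b : V} (h : G.Adj a b) (ha : a ∈ S) (hb : b ∈ S) :
    JoinedIn G S a b :=
  ⟨.cons h .nil, by simp [ha, hb]⟩

theorem JoinedIn.reachable_map {S : Set V} {a b : V} (h : JoinedIn G S a b) (ha : a ∈ S)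
    (hb : b ∈ S) {X : Type*} {K : SimpleGraph X} (f : G.induce S →g K) :
    K.Reachable (f ⟨a, ha⟩) (f ⟨b, hb⟩) := by
  obtain ⟨w, hw⟩ := h
  exact ⟨(w.induce S hw).map f⟩

theorem JoinedIn.of_reachable_induce {S : Set V} {a b : S} (h : (G.induce S).Reachable a b) :
    JoinedIn G S a b := by
  obtain ⟨w⟩ := h
  let f : G.induce S →g G := ⟨Subtype.val, fun h => h⟩
  refine ⟨w.map f, fun x (hx : x ∈ (w.map f).support) => ?_⟩
  rw [SimpleGraph.Walk.support_map, List.mem_map] at hx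
  obtain ⟨y, -, rfl⟩ := hx
  exact y.2

theorem isCutVertex_iff {v : V} : IsCutVertex G v ↔
    ∃ a b, a ≠ v ∧ b ≠ v ∧ G.Reachable a b ∧ ¬ JoinedIn G {u | u ≠ v} a b := by
  constructor
  · rintro ⟨a, b, ha, hb, hr, hn⟩
    exact ⟨a, b, ha, hb, hr, fun h => hn (h.reachable_map ha hb .id)⟩
  · rintro ⟨a, b, ha, hb, hr, hn⟩
    exact ⟨a, b, ha, hb, hr, fun h => hn (JoinedIn.of_reachable_induce h)⟩

/-- The vertex set `S` induces a connected subgraph without cut vertices. -/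
structure IsBiconnectedSet (G : SimpleGraph V) (S : Set V) : Prop where
  nonempty : S.Nonempty
  joined : ∀ a ∈ S, ∀ b ∈ S, JoinedIn G S a b
  joined_diff : ∀ z, ∀ a ∈ S, ∀ b ∈ S, a ≠ z → b ≠ z → JoinedIn G (S \ {z}) a b

theorem IsBiconnectedSet.isBiconnected {S : Set V} (hS : IsBiconnectedSet G S) :
    IsBiconnected ((⊤ : G.Subgraph).induce S).coe := by
  constructor
  · rw [SimpleGraph.connected_iff]
    refine ⟨fun a b => ?_, hS.nonempty.to_subtype⟩
    let f : G.induce S →g ((⊤ : G.Subgraph).induce S).coe :=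
      ⟨fun x => ⟨x.1, x.2⟩, fun {x y} h => ⟨x.2, y.2, h⟩⟩
    exact (hS.joined a a.2 b b.2).reachable_map a.2 b.2 f
  · rintro z ⟨a, b, ha, hb, -, hn⟩
    have haz : (a : V) ≠ z := fun h => ha (Subtype.ext h)
    have hbz : (b : V) ≠ z := fun h => hb (Subtype.ext h)
    let f : G.induce (S \ {(z : V)}) →g ((⊤ : G.Subgraph).induce S).coe.induce {u | u ≠ z} :=
      ⟨fun x => ⟨⟨x.1, x.2.1⟩, fun h => x.2.2 (congrArg Subtype.val h)⟩,
        fun {x y} h => ⟨x.2.1, y.2.1, h⟩⟩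
    exact hn ((hS.joined_diff z a a.2 b b.2 haz hbz).reachable_map ⟨a.2, haz⟩ ⟨b.2, hbz⟩ f)

theorem isBiconnectedSet_pair {u v : V} (h : G.Adj u v) : IsBiconnectedSet G {u, v} := by
  refine ⟨⟨u, by simp⟩, ?_, ?_⟩
  · rintro a (rfl | rfl) b (rfl | rfl)
    · exact .refl (by simp)
    · exact .of_adj h (by simp) (by simp)
    · exact .of_adj h.symm (by simp) (by simp)
    · exact .refl (by simp)
  · rintro z a (rfl | rfl) b (rfl | rfl) ha hb
    · exact .refl ⟨by simp, ha⟩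
    · exact .of_adj h ⟨by simp, ha⟩ ⟨by simp, hb⟩
    · exact .of_adj h.symm ⟨by simp, ha⟩ ⟨by simp, hb⟩
    · exact .refl ⟨by simp, ha⟩

/-- A connected set together with a common neighbour of its vertices is biconnected. -/
theorem isBiconnectedSet_insert {D : Set V} {p : V} (hD : ∀ a ∈ D, ∀ b ∈ D, JoinedIn G D a b)
    (hpD : ∀ a ∈ D, G.Adj p a) : IsBiconnectedSet G (insert p D) := by
  have hp : ∀ T : Set V, p ∈ T → ∀ a, a ∈ insert p D → a ∈ T → JoinedIn G T p a := by
    rintro T hT a (rfl | ha) haT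
    · exact .refl hT
    · exact .of_adj (hpD a ha) hT haT
  refine ⟨⟨p, by simp⟩, fun a ha b hb => ?_, fun z a ha b hb haz hbz => ?_⟩
  · exact (hp _ (by simp) a ha ha).symm.trans (hp _ (by simp) b hb hb)
  · by_cases hz : z = p
    · subst hz
      have ha' := ha.resolve_left haz
      have hb' := hb.resolve_left hbz
      refine (hD a ha' b hb').mono fun x hx => ⟨Or.inr hx, ?_⟩
      rintro rfl
      exact (hpD _ hx).ne rfl
    · have hp' : p ∈ insert p D \ {z} := ⟨by simp, fun h => hz h.symm⟩
      exact (hp _ hp' a ha ⟨ha, haz⟩).symm.trans (hp _ hp' b hb ⟨hb, hbz⟩)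

/-- Adding an ear to a biconnected set keeps it biconnected. -/
theorem IsBiconnectedSet.union_path {S : Set V} (hS : IsBiconnectedSet G S) {c s : V}
    (hc : c ∈ S) (hs : s ∈ S) (P : G.Walk c s) (hP : P.IsPath) :
    IsBiconnectedSet G (S ∪ {x | x ∈ P.support}) := by
  classical
  -- A vertex `z` cannot separate a vertex `x` of the ear from both ends of the ear.
  have key : ∀ z x, x ∈ S ∪ {x | x ∈ P.support} → x ≠ z →
      ∃ t ∈ S, t ≠ z ∧ JoinedIn G ((S ∪ {x | x ∈ P.support}) \ {z}) x t := by
    rintro z x (hx | hx) hxz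
    · exact ⟨x, hx, hxz, .refl ⟨Or.inl hx, hxz⟩⟩
    · by_cases hz : z ∈ (P.takeUntil x hx).support
      · have hz' : z ∉ (P.dropUntil x hx).support := by
          intro hz'
          have hPa := hP
          rw [← P.take_spec hx] at hPa
          exact hPa.ne_of_mem_support_of_append hxz.symm hz hz' rfl
        refine ⟨s, hs, fun h => hz' (h ▸ SimpleGraph.Walk.end_mem_support _),
          P.dropUntil x hx, fun y hy => ⟨Or.inr ?_, fun h => hz' (h ▸ hy)⟩⟩
        exact P.support_dropUntil_subset_support hx hy
      · refine ⟨c, hc, fun h => hz (h ▸ SimpleGraph.Walk.start_mem_support _),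
          (P.takeUntil x hx).reverse, fun y hy => ?_⟩
        rw [SimpleGraph.Walk.support_reverse, List.mem_reverse] at hy
        exact ⟨Or.inr (P.support_takeUntil_subset_support hx hy), fun h => hz (h ▸ hy)⟩
  have hS_mono : S ⊆ S ∪ {x | x ∈ P.support} := Set.subset_union_left
  refine ⟨⟨c, Or.inl hc⟩, fun a ha b hb => ?_, fun z a ha b hb haz hbz => ?_⟩
  · have hstart : ∀ x ∈ S ∪ {x | x ∈ P.support},
        JoinedIn G (S ∪ {x | x ∈ P.support}) c x := by
      rintro x (hx | hx)
      · exact (hS.joined c hc x hx).mono hS_mono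
      · exact ⟨P.takeUntil x hx, fun y hy =>
          Or.inr (P.support_takeUntil_subset_support hx hy)⟩
    exact (hstart a ha).symm.trans (hstart b hb)
  · obtain ⟨t, ht, htz, hat⟩ := key z a ha haz
    obtain ⟨t', ht', htz', hbt⟩ := key z b hb hbz
    exact (hat.trans ((hS.joined_diff z t ht t' ht' htz htz').mono
      (Set.sdiff_subset_sdiff_left hS_mono))).trans hbt.symm

end

/-! ### The tree of a graph whose cut vertices are universal in their blocks -/

section

variable {V : Type*} {G : SimpleGraph V}

/-- The hypotheses on the blocks of `G`, stated for all biconnected vertex sets instead of only the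
maximal ones, and with representations given by coordinates. -/
structure IsBlockwiseLRep (G : SimpleGraph V) : Prop where
  hasLRep : ∀ S, IsBiconnectedSet G S → HasLRep (G.induce S)
  adj_of_isCutVertex : ∀ v, IsCutVertex G v → ∀ S, IsBiconnectedSet G S → v ∈ S →
    ∀ w ∈ S, w ≠ v → G.Adj v w

theorem isBlockwiseLRep_of_blocks [Finite V]
    (hblock : ∀ B : G.Subgraph, IsBlock G B → IsLEPG B.coe)
    (hcut : ∀ v : V, IsCutVertex G v → ∀ B : G.Subgraph, IsBlock G B →
      ∀ hv : v ∈ B.verts, IsUniversal B.coe ⟨v, hv⟩) : IsBlockwiseLRep G := by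
  have key : ∀ S, IsBiconnectedSet G S →
      ∃ B : G.Subgraph, IsBlock G B ∧ (⊤ : G.Subgraph).induce S ≤ B := by
    intro S hS
    obtain ⟨B, hB, hmax⟩ := Finite.exists_le_maximal
      (p := fun H : G.Subgraph => IsBiconnected H.coe) hS.isBiconnected
    exact ⟨B, hmax, hB⟩
  constructor
  · intro S hS
    obtain ⟨B, hB, hle⟩ := key S hS
    refine (hblock B hB).hasLRep.comap ⟨⟨fun x => ⟨x.1, hle.1 x.2⟩, ?_⟩, ?_⟩
    · intro x y h
      exact Subtype.ext (congrArg (fun z : B.verts => (z : V)) h)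
    · intro x y
      exact ⟨fun h => B.adj_sub h, fun h => hle.2 ⟨x.2, y.2, h⟩⟩
  · intro v hv S hS hvS w hw hwv
    obtain ⟨B, hB, hle⟩ := key S hS
    exact B.adj_sub (hcut v hv B hB (hle.1 hvS) ⟨w, hle.1 hw⟩
      fun h => hwv (congrArg (fun z : B.verts => (z : V)) h))

theorem JoinedIn.map_val {K : Set V} {S : Set K} {a b : K} (h : JoinedIn (G.induce K) S a b) :
    JoinedIn G (Subtype.val '' S) (a : V) b := by
  obtain ⟨w, hw⟩ := h
  let f : G.induce K →g G := ⟨Subtype.val, fun h => h⟩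
  refine ⟨w.map f, fun x (hx : x ∈ (w.map f).support) => ?_⟩
  rw [SimpleGraph.Walk.support_map, List.mem_map] at hx
  obtain ⟨y, hy, rfl⟩ := hx
  exact ⟨y, hw y hy, rfl⟩

theorem IsBiconnectedSet.map_val {K : Set V} {S : Set K} (hS : IsBiconnectedSet (G.induce K) S) :
    IsBiconnectedSet G (Subtype.val '' S) := by
  refine ⟨hS.nonempty.image _, ?_, ?_⟩
  · rintro _ ⟨a, ha, rfl⟩ _ ⟨b, hb, rfl⟩
    exact (hS.joined a ha b hb).map_val
  · rintro z _ ⟨a, ha, rfl⟩ _ ⟨b, hb, rfl⟩ haz hbz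
    by_cases hz : z ∈ K
    · refine (hS.joined_diff ⟨z, hz⟩ a ha b hb (fun h => haz (congrArg Subtype.val h))
        (fun h => hbz (congrArg Subtype.val h))).map_val.mono ?_
      rintro _ ⟨x, ⟨hx, hxz⟩, rfl⟩
      exact ⟨⟨x, hx, rfl⟩, fun h => hxz (Subtype.ext h)⟩
    · refine (hS.joined a ha b hb).map_val.mono ?_
      rintro _ ⟨x, hx, rfl⟩
      exact ⟨⟨x, hx, rfl⟩, fun h => hz (h ▸ x.2)⟩

theorem JoinedIn.inter_supp {S : Set V} {a b : V} (c : G.ConnectedComponent)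
    (h : JoinedIn G S a b) (ha : a ∈ c.supp) : JoinedIn G (S ∩ c.supp) a b := by
  classical
  obtain ⟨w, hw⟩ := h
  refine ⟨w, fun x hx => ⟨hw x hx, ?_⟩⟩
  rw [SimpleGraph.ConnectedComponent.mem_supp_iff] at ha ⊢
  rw [← ha]
  exact (SimpleGraph.ConnectedComponent.sound ⟨w.takeUntil x hx⟩).symm

theorem IsBlockwiseLRep.induce_supp (hG : IsBlockwiseLRep G) (c : G.ConnectedComponent) :
    IsBlockwiseLRep (G.induce c.supp) := by
  constructor
  · intro S hS
    refine (hG.hasLRep _ hS.map_val).comap ⟨⟨fun x => ⟨x.1, x.1, x.2, rfl⟩, ?_⟩, Iff.rfl⟩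
    intro x y h
    exact Subtype.ext (Subtype.ext (Subtype.mk.inj h))
  · intro v hv S hS hvS w hw hwv
    refine hG.adj_of_isCutVertex v ?_ _ hS.map_val ⟨v, hvS, rfl⟩ w ⟨w, hw, rfl⟩
      fun h => hwv (Subtype.ext h)
    obtain ⟨a, b, ha, hb, hr, hn⟩ := isCutVertex_iff.1 hv
    let f : G.induce c.supp →g G := ⟨Subtype.val, fun h => h⟩
    refine isCutVertex_iff.2 ⟨a, b, fun h => ha (Subtype.ext h), fun h => hb (Subtype.ext h),
      hr.map f, fun hj => hn ?_⟩
    obtain ⟨q, hq⟩ := hj.inter_supp c a.2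
    have hq' : ∀ x ∈ q.support, x ∈ c.supp := fun x hx => (hq x hx).2
    refine ⟨q.induce _ hq', fun x hx => ?_⟩
    rw [SimpleGraph.Walk.support_induce, List.mem_attachWith] at hx
    exact fun h => (hq x hx).1 (congrArg Subtype.val h)

/-- A connected graph without cut vertices is its own block. -/
theorem IsBlockwiseLRep.hasLRep_of_no_cutVertex (hG : IsBlockwiseLRep G) (hconn : G.Connected)
    (hcut : ∀ v, ¬ IsCutVertex G v) : HasLRep G := by
  have huniv : IsBiconnectedSet G Set.univ := by
    obtain ⟨v⟩ := hconn.nonempty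
    refine ⟨⟨v, trivial⟩, fun a _ b _ => ?_, fun z a _ b _ ha hb => ?_⟩
    · obtain ⟨w⟩ := hconn.preconnected a b
      exact ⟨w, fun _ _ => trivial⟩
    · by_contra hn
      exact hcut z (isCutVertex_iff.2 ⟨a, b, ha, hb, hconn.preconnected a b,
        fun h => hn (h.mono fun x hx => ⟨trivial, hx⟩)⟩)
  exact (hG.hasLRep _ huniv).comap ⟨⟨fun x => ⟨x, trivial⟩, fun x y h =>
    congrArg Subtype.val h⟩, Iff.rfl⟩

theorem exists_adj_dist_eq_add_one (hconn : G.Connected) {r v : V} (hv : v ≠ r) :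
    ∃ p, G.Adj p v ∧ G.dist r v = G.dist r p + 1 := by
  obtain ⟨w, hw⟩ := hconn.exists_walk_length_eq_dist v r
  cases w with
  | nil => exact absurd rfl hv
  | @cons _ p _ h w =>
    refine ⟨p, h.symm, ?_⟩
    rw [SimpleGraph.Walk.length_cons] at hw
    have h1 := SimpleGraph.dist_le w
    have h2 := hconn.dist_triangle (u := v) (v := p) (w := r)
    rw [SimpleGraph.dist_eq_one_iff_adj.2 h] at h2
    rw [G.dist_comm (u := r), G.dist_comm (u := r)]
    omega

theorem joinedIn_dist_lt (hconn : G.Connected) (r v : V) :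
    JoinedIn G {x | x = v ∨ G.dist r x < G.dist r v} v r := by
  induction hd : G.dist r v using Nat.strong_induction_on generalizing v with
  | _ d ih =>
    by_cases hv : v = r
    · subst hv
      exact .refl (Or.inl rfl)
    · obtain ⟨p, hp, hpd⟩ := exists_adj_dist_eq_add_one hconn hv
      refine (JoinedIn.of_adj hp.symm (Or.inl rfl) (Or.inr (by omega))).trans
        ((ih (G.dist r p) (by omega) p rfl).mono ?_)
      rintro x (rfl | hx)
      · right; omega
      · right; omega

/-- A vertex `c` of a maximal biconnected set `S` that is nearest to `r` separates the rest of `S`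
from `r`: a walk to `r` that avoids `c` would give an ear of `S` through the predecessor of `c` on
a shortest path from `r`, which is not in `S`. -/
theorem not_joinedIn_of_nearest (hconn : G.Connected) {S : Set V}
    (hS : Maximal (IsBiconnectedSet G) S) {r c s : V} (hcr : c ≠ r) (hc : c ∈ S)
    (hmin : ∀ x ∈ S, G.dist r c ≤ G.dist r x) (hs : s ∈ S) :
    ¬ JoinedIn G {x | x ≠ c} s r := by
  classical
  intro hJ
  obtain ⟨q, hq, hqd⟩ := exists_adj_dist_eq_add_one hconn hcr
  have hqr : JoinedIn G {x | x ≠ c} q r := by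
    refine (joinedIn_dist_lt hconn r q).mono ?_
    rintro x (rfl | hx) rfl
    · exact hq.ne rfl
    · omega
  obtain ⟨w, hw⟩ := hqr.trans hJ.symm
  have hP : (SimpleGraph.Walk.cons hq.symm w.bypass).IsPath := by
    rw [SimpleGraph.Walk.cons_isPath_iff]
    exact ⟨w.bypass_isPath, fun h => hw c (w.support_bypass_subset_support h) rfl⟩
  have hle := hS.2 (hS.1.union_path hc hs _ hP) Set.subset_union_left
  have hqS : q ∈ S := by
    refine hle (Or.inr ?_)
    simp
  have := hmin q hqS
  omega

/-- Every edge that leads away from the cut vertex `r` starts at a vertex that separates its other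
end from `r`. Indeed, the vertex nearest to `r` of a block containing the edge is a cut vertex,
so it is adjacent to the rest of the block, which forces it to be the end nearer to `r`. -/
theorem IsBlockwiseLRep.not_joinedIn [Finite V] (hG : IsBlockwiseLRep G) (hconn : G.Connected)
    {r : V} (hr : IsCutVertex G r) {p u : V} (hpu : G.Adj p u)
    (hd : G.dist r u = G.dist r p + 1) : ¬ JoinedIn G {x | x ≠ p} u r := by
  by_cases hpr : p = r
  · rintro ⟨w, hw⟩
    exact hw r w.end_mem_support hpr.symm
  obtain ⟨S, hpS, hS⟩ := Finite.exists_le_maximal (p := IsBiconnectedSet G)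
    (isBiconnectedSet_pair hpu)
  have hp : p ∈ S := hpS (by simp)
  have hu : u ∈ S := hpS (by simp)
  obtain ⟨c, hc, hmin⟩ := Set.exists_min_image S (G.dist r) S.toFinite ⟨p, hp⟩
  have hcp := hmin p hp
  have huc : u ≠ c := by
    rintro rfl
    omega
  have hcut : IsCutVertex G c := by
    by_cases hcr : c = r
    · exact hcr ▸ hr
    · exact isCutVertex_iff.2 ⟨u, r, huc, Ne.symm hcr, hconn.preconnected u r,
        not_joinedIn_of_nearest hconn hS hcr hc hmin hu⟩
  have hcu := hG.adj_of_isCutVertex c hcut S hS.1 hc u hu huc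
  have hdc : G.dist r u ≤ G.dist r c + 1 := by
    have := hconn.dist_triangle (u := r) (v := c) (w := u)
    rwa [SimpleGraph.dist_eq_one_iff_adj.2 hcu] at this
  have hcr : c ≠ r := by
    rintro rfl
    have h0 : G.dist c p = 0 := by
      rw [SimpleGraph.dist_self] at hdc
      omega
    exact hpr ((hconn.dist_eq_zero_iff.1 h0).symm)
  have hpc : p = c := by
    by_contra hne
    refine not_joinedIn_of_nearest hconn hS hcr hc hmin hp ((joinedIn_dist_lt hconn r p).mono ?_)
    rintro x (rfl | hx) rfl
    · exact hne rfl
    · omega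
  subst hpc
  exact not_joinedIn_of_nearest hconn hS hcr hc hmin hu

/-- A vertex with a neighbour farther from `r` is a cut vertex. -/
theorem IsBlockwiseLRep.isCutVertex_of_adj [Finite V] (hG : IsBlockwiseLRep G)
    (hconn : G.Connected) {r : V} (hr : IsCutVertex G r) {p u : V} (hpu : G.Adj p u)
    (hd : G.dist r u = G.dist r p + 1) : IsCutVertex G p := by
  by_cases hpr : p = r
  · exact hpr ▸ hr
  · exact isCutVertex_iff.2 ⟨u, r, hpu.ne', Ne.symm hpr, hconn.preconnected u r,
      hG.not_joinedIn hconn hr hpu hd⟩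

/-- The neighbour nearer to `r` is unique, and adjacent vertices at the same distance from `r`
have it in common. -/
theorem IsBlockwiseLRep.parent_unique [Finite V] (hG : IsBlockwiseLRep G)
    (hconn : G.Connected) {r : V} (hr : IsCutVertex G r) {p u q v : V} (hpu : G.Adj p u)
    (hd : G.dist r u = G.dist r p + 1) (hqv : G.Adj q v) (hd' : G.dist r v = G.dist r q + 1)
    (huv : u = v ∨ G.Adj u v) (hduv : G.dist r u = G.dist r v) : p = q := by
  by_contra hne
  refine hG.not_joinedIn hconn hr hpu hd ?_
  have hup : u ≠ p := hpu.ne'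
  have hvp : v ≠ p := by
    rintro rfl
    omega
  have h1 : JoinedIn G {x | x ≠ p} u v := by
    rcases huv with rfl | h
    · exact .refl hup
    · exact .of_adj h hup hvp
  refine (h1.trans (.of_adj hqv.symm hvp (Ne.symm hne))).trans
    ((joinedIn_dist_lt hconn r q).mono ?_)
  rintro x (rfl | hx) rfl
  · exact hne rfl
  · omega

end

/-! ### Intervals for the children of a vertex -/

section

variable {V : Type*} {G : SimpleGraph V}

/-- The graph `G` without the edges between vertices at different distances from `r`. -/
def levelGraph (G : SimpleGraph V) (r : V) : SimpleGraph V where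
  Adj u v := G.Adj u v ∧ G.dist r u = G.dist r v
  symm := ⟨fun _ _ h => ⟨h.1.symm, h.2.symm⟩⟩
  loopless := ⟨fun _ h => h.1.ne rfl⟩

theorem dist_eq_of_reachable_levelGraph {r u v : V} (h : (levelGraph G r).Reachable u v) :
    G.dist r u = G.dist r v := by
  obtain ⟨w⟩ := h
  induction w with
  | nil => rfl
  | cons h _ ih => exact h.2.trans ih

theorem joinedIn_levelGraph_component {r u a b : V} (ha : (levelGraph G r).Reachable u a)
    (hb : (levelGraph G r).Reachable u b) :
    JoinedIn G {x | (levelGraph G r).Reachable u x} a b := by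
  obtain ⟨w⟩ := ha.symm.trans hb
  clear hb
  induction w with
  | nil => exact .refl ha
  | cons h _ ih =>
    have h' := ha.trans h.reachable
    exact (JoinedIn.of_adj h.1 ha h').trans (ih h')

/-- A connected set `D` of neighbours of `p` induces an interval graph, because `p` is universal in
the biconnected set `insert p D`. -/
theorem IsBlockwiseLRep.exists_intervals (hG : IsBlockwiseLRep G)
    {D : Set V} {p : V} (hD : ∀ a ∈ D, ∀ b ∈ D, JoinedIn G D a b) (hpD : ∀ a ∈ D, G.Adj p a) :
    ∃ a b : V → ℤ, ∀ u ∈ D, a u < b u ∧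
      ∀ v ∈ D, u ≠ v → (G.Adj u v ↔ Overlap (a u) (b u) (a v) (b v)) := by
  classical
  have hp : p ∈ insert p D := by simp
  have huniv : IsUniversal (G.induce (insert p D)) ⟨p, hp⟩ := by
    rintro ⟨w, hw⟩ hne
    exact hpD w (hw.resolve_left fun h => hne (Subtype.ext h))
  obtain ⟨a, b, hab⟩ := (hG.hasLRep _ (isBiconnectedSet_insert hD hpD)).exists_intervals _ huniv
  refine ⟨fun v => if hv : v ∈ insert p D then a ⟨v, hv⟩ else 0,
    fun v => if hv : v ∈ insert p D then b ⟨v, hv⟩ else 0, fun u hu => ?_⟩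
  have hmem : ∀ v ∈ D, v ∈ insert p D := fun v hv => Or.inr hv
  have hne : ∀ v (hv : v ∈ D), (⟨v, hmem v hv⟩ : ↥(insert p D)) ≠ ⟨p, hp⟩ := by
    intro v hv h
    exact (hpD v hv).ne (congrArg Subtype.val h).symm
  obtain ⟨hlt, h⟩ := hab ⟨u, hmem u hu⟩ (hne u hu)
  simp only [hmem u hu, dif_pos]
  refine ⟨hlt, fun v hv huv => ?_⟩
  simp only [hmem v hv, dif_pos]
  exact h ⟨v, hmem v hv⟩ (hne v hv) fun h => huv (congrArg Subtype.val h)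

theorem exists_abs_lt [Finite V] (f : V → ℤ) : ∃ N : ℤ, 0 < N ∧ ∀ v, |f v| < N := by
  have : Fintype V := Fintype.ofFinite V
  have h0 : 0 ≤ ∑ v, |f v| := Finset.sum_nonneg fun v _ => abs_nonneg _
  refine ⟨∑ v, |f v| + 1, by omega, fun v => ?_⟩
  have := Finset.single_le_sum (f := fun v => |f v|) (fun v _ => abs_nonneg _) (Finset.mem_univ v)
  omega

/-- Intervals for all vertices at once: `key v` numbers the component of `v` in the level graph, so
that components farther from `r` get larger numbers, and the intervals in component number `k` lie
in `[M * k, M * (k + 1))`. A vertex with children is a cut vertex, so it is adjacent to all others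
in its component; extending its interval to the left therefore changes no adjacency, and makes the
left ends of all these intervals distinct. -/
theorem IsBlockwiseLRep.exists_positions [Finite V] (hG : IsBlockwiseLRep G)
    (hconn : G.Connected) {r : V} (hr : IsCutVertex G r) (par : V → V)
    (hpar : ∀ v, v ≠ r → G.Adj (par v) v ∧ G.dist r v = G.dist r (par v) + 1)
    (hlevel : ∀ u v, u ≠ r → (levelGraph G r).Reachable u v → par u = par v) :
    ∃ pos top : V → ℤ, (∀ v, 0 ≤ pos v) ∧ (∀ v, pos v < top v) ∧
      (∀ u v, G.dist r u < G.dist r v → pos u < pos v) ∧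
      (∀ u v, u ≠ r → v ≠ r → pos (par u) = pos (par v) → par u = par v) ∧
      (∀ u v, u ≠ v → G.dist r u = G.dist r v →
        (G.Adj u v ↔ Overlap (pos u) (top u) (pos v) (top v))) := by
  classical
  let L := levelGraph G r
  obtain ⟨ρ, hρ, hρ_eq⟩ : ∃ ρ : V → V, (∀ v, L.Reachable (ρ v) v) ∧
      ∀ u v, ρ u = ρ v ↔ L.Reachable u v := by
    have h1 : ∀ v, L.connectedComponentMk (L.connectedComponentMk v).out =
        L.connectedComponentMk v := fun v => Quot.out_eq _
    refine ⟨fun v => (L.connectedComponentMk v).out,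
      fun v => SimpleGraph.ConnectedComponent.exact (h1 v), fun u v => ⟨fun h => ?_, fun h => ?_⟩⟩
    · have h2 := congrArg L.connectedComponentMk h
      rw [h1, h1] at h2
      exact SimpleGraph.ConnectedComponent.exact h2
    · dsimp only
      rw [SimpleGraph.ConnectedComponent.sound h]
  have hparL : ∀ u, u ≠ r → ∀ v, L.Reachable u v → G.Adj (par u) v := by
    intro u hu v huv
    rw [hlevel u v hu huv]
    refine (hpar v ?_).1
    rintro rfl
    have h1 := dist_eq_of_reachable_levelGraph huv
    rw [SimpleGraph.dist_self] at h1
    exact hu (hconn.dist_eq_zero_iff.1 h1).symm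
  have hint : ∀ t, ∃ a b : V → ℤ, ∀ u, L.Reachable t u → a u < b u ∧
      ∀ v, L.Reachable t v → u ≠ v → (G.Adj u v ↔ Overlap (a u) (b u) (a v) (b v)) := by
    intro t
    by_cases ht : t = r
    · subst ht
      refine ⟨fun _ => 0, fun _ => 1, fun u hu => ⟨by norm_num, fun v hv huv => ?_⟩⟩
      have h1 := dist_eq_of_reachable_levelGraph hu
      have h2 := dist_eq_of_reachable_levelGraph hv
      rw [SimpleGraph.dist_self] at h1 h2
      exact absurd ((hconn.dist_eq_zero_iff.1 h1.symm).symm.trans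
        (hconn.dist_eq_zero_iff.1 h2.symm)) huv
    · exact hG.exists_intervals (D := {x | L.Reachable t x})
        (fun a ha b hb => joinedIn_levelGraph_component ha hb) (hparL t ht)
  choose a b hab using hint
  obtain ⟨n, ⟨idx⟩⟩ := Finite.exists_equiv_fin V
  have hidx : ∀ v, ((idx v : ℕ) : ℤ) < n := fun v => by exact_mod_cast (idx v).2
  obtain ⟨A, hA0, hA⟩ := exists_abs_lt fun v => a (ρ v) v
  obtain ⟨C, hC0, hC⟩ := exists_abs_lt fun v => b (ρ v) v
  let HasChild : V → Prop := fun v => ∃ u, u ≠ r ∧ par u = v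
  obtain ⟨l, hl⟩ : ∃ l : V → ℤ, ∀ v, l v =
      if HasChild v then ((idx v : ℕ) : ℤ) else n + A + a (ρ v) v := ⟨_, fun _ => rfl⟩
  obtain ⟨M, hM⟩ : ∃ M : ℤ, M = n + A + C := ⟨_, rfl⟩
  have hl0 : ∀ v, 0 ≤ l v ∧ l v ≤ n + A + a (ρ v) v := by
    intro v
    have h1 := abs_lt.1 (hA v)
    have h2 := hidx v
    rw [hl]
    split_ifs <;> omega
  have hlb : ∀ v, l v < n + A + b (ρ v) v ∧ n + A + b (ρ v) v ≤ M := by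
    intro v
    have h1 := abs_lt.1 (hC v)
    have h2 := (hab (ρ v) v (hρ v)).1
    have h3 := hl0 v
    omega
  have hM0 : 0 < M := by omega
  obtain ⟨key, hkey⟩ : ∃ key : V → ℤ, ∀ v, key v = n * (G.dist r v : ℕ) + (idx (ρ v) : ℕ) :=
    ⟨_, fun _ => rfl⟩
  have hkey0 : ∀ v, 0 ≤ key v := fun v => by rw [hkey]; positivity
  have hkey_lt : ∀ u v, G.dist r u < G.dist r v → key u < key v := by
    intro u v huv
    have h1 : (G.dist r u : ℤ) + 1 ≤ G.dist r v := by exact_mod_cast huv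
    have h2 := hidx (ρ u)
    have h3 : (0 : ℤ) ≤ (idx (ρ v) : ℕ) := by positivity
    have h4 := mul_le_mul_of_nonneg_left h1 (Int.natCast_nonneg n)
    rw [mul_add, mul_one] at h4
    rw [hkey, hkey]
    omega
  have hpos_lt : ∀ u v, key u < key v →
      M * key u + (n + A + b (ρ u) u) ≤ M * key v + l v := by
    intro u v huv
    have h1 := mul_le_mul_of_nonneg_left (show key u + 1 ≤ key v from huv) hM0.le
    have h2 := hl0 v
    have h3 := hlb u
    rw [mul_add, mul_one] at h1
    omega
  have huniv : ∀ u v, HasChild u → u ≠ v → L.Reachable u v → G.Adj u v := by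
    rintro u v ⟨w, hw, rfl⟩ huv hL
    have hcut := hG.isCutVertex_of_adj hconn hr (hpar w hw).1 (hpar w hw).2
    by_cases hwr : par w = r
    · have h1 := dist_eq_of_reachable_levelGraph hL
      rw [hwr, SimpleGraph.dist_self] at h1
      exact absurd (hwr.trans (hconn.dist_eq_zero_iff.1 h1.symm)) huv
    · refine hG.adj_of_isCutVertex _ hcut _ (isBiconnectedSet_insert
        (D := {x | L.Reachable (par w) x})
        (fun a ha b hb => joinedIn_levelGraph_component ha hb) (hparL _ hwr)) (Or.inr ?_) v
        (Or.inr hL) (Ne.symm huv)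
      exact SimpleGraph.Reachable.refl _
  refine ⟨fun v => M * key v + l v, fun v => M * key v + (n + A + b (ρ v) v), fun v => ?_,
    fun v => ?_, fun u v huv => ?_, fun u v hu hv huv => ?_, fun u v huv hd => ?_⟩
  · have h1 := hl0 v
    have h2 := mul_nonneg hM0.le (hkey0 v)
    dsimp only
    omega
  · have := hlb v
    dsimp only
    omega
  · have h1 := hpos_lt u v (hkey_lt u v huv)
    have h2 := hlb u
    dsimp only
    omega
  · dsimp only at huv
    have hk : key (par u) = key (par v) := by
      rcases lt_trichotomy (key (par u)) (key (par v)) with h | h | h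
      · have h1 := hpos_lt _ _ h
        have h2 := hlb (par u)
        omega
      · exact h
      · have h1 := hpos_lt _ _ h
        have h2 := hlb (par v)
        omega
    rw [hk, add_right_inj, hl, hl, if_pos ⟨u, hu, rfl⟩, if_pos ⟨v, hv, rfl⟩] at huv
    exact idx.injective (Fin.ext (by exact_mod_cast huv))
  · dsimp only
    constructor
    · intro hadj
      have hL : L.Reachable u v := SimpleGraph.Adj.reachable (G := L) ⟨hadj, hd⟩
      have hρuv := (hρ_eq u v).2 hL
      have hk : key u = key v := by rw [hkey, hkey, hd, hρuv]
      have h1 := ((hab (ρ u) u (hρ u)).2 v (hρuv ▸ hρ v) huv).1 hadj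
      have h2 := hl0 u
      have h3 := hl0 v
      have h4 := hlb u
      have h5 := hlb v
      rw [hk]
      rw [hρuv] at h1 h2 h4 ⊢
      unfold Overlap at h1 ⊢
      omega
    · intro ho
      have hk : key u = key v := by
        unfold Overlap at ho
        rcases lt_trichotomy (key u) (key v) with h | h | h
        · have h1 := hpos_lt _ _ h
          omega
        · exact h
        · have h1 := hpos_lt _ _ h
          omega
      have hρuv : ρ u = ρ v := by
        rw [hkey, hkey, hd, add_right_inj] at hk
        exact idx.injective (Fin.ext (by exact_mod_cast hk))
      have hL := (hρ_eq u v).1 hρuv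
      by_cases hu : HasChild u
      · exact huniv u v hu huv hL
      by_cases hv : HasChild v
      · exact (huniv v u hv (Ne.symm huv) hL.symm).symm
      refine ((hab (ρ u) u (hρ u)).2 v (hρuv ▸ hρ v) huv).2 ?_
      rw [hk, hl, hl, if_neg hu, if_neg hv, hρuv] at ho
      rw [hρuv]
      unfold Overlap at ho ⊢
      omega

theorem IsBlockwiseLRep.hasLRep_of_cutVertex [Finite V] (hG : IsBlockwiseLRep G)
    (hconn : G.Connected) {r : V} (hr : IsCutVertex G r) : HasLRep G := by
  have hex : ∀ v, ∃ p, v ≠ r → G.Adj p v ∧ G.dist r v = G.dist r p + 1 := by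
    intro v
    by_cases hv : v = r
    · exact ⟨v, fun h => absurd hv h⟩
    · obtain ⟨p, hp⟩ := exists_adj_dist_eq_add_one hconn hv
      exact ⟨p, fun _ => hp⟩
  choose par hpar using hex
  have hne : ∀ {v}, v ≠ r ↔ 0 < G.dist r v := by
    intro v
    rw [Nat.pos_iff_ne_zero, ne_eq, ne_eq, hconn.dist_eq_zero_iff, eq_comm]
  have hsib : ∀ u v, u ≠ r → (u = v ∨ G.Adj u v) → G.dist r u = G.dist r v →
      par u = par v := by
    intro u v hu huv hd
    have hv : v ≠ r := hne.2 (hd ▸ hne.1 hu)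
    exact hG.parent_unique hconn hr (hpar u hu).1 (hpar u hu).2 (hpar v hv).1 (hpar v hv).2 huv hd
  have huniq : ∀ u v, G.Adj u v → G.dist r v = G.dist r u + 1 → v ≠ r ∧ par v = u := by
    intro u v hadj hd
    have hv : v ≠ r := hne.2 (by omega)
    exact ⟨hv, hG.parent_unique hconn hr (hpar v hv).1 (hpar v hv).2 hadj hd (Or.inl rfl) rfl⟩
  have hlevel : ∀ u v, u ≠ r → (levelGraph G r).Reachable u v → par u = par v := by
    rintro u v hu ⟨w⟩
    induction w with
    | nil => rfl
    | cons h _ ih => exact (hsib _ _ hu (Or.inr h.1) h.2).trans (ih (hne.2 (h.2 ▸ hne.1 hu)))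
  obtain ⟨pos, top, hpos, hlt, hmono, hinj, hadj⟩ :=
    hG.exists_positions hconn hr par hpar hlevel
  obtain ⟨N, -, hN⟩ := exists_abs_lt top
  refine hasLRep_of_layout G r par (fun v => Even (G.dist r v)) pos top N hpos hlt
    (fun v => (abs_lt.1 (hN v)).2.le) (by simp) (fun v hv => ?_) (fun v hv hpv => ?_)
    (fun u v hu hv _ => hinj u v hu hv) (fun u v huv => ⟨fun h => ?_, ?_⟩)
  · rw [(hpar v hv).2, Nat.even_add_one]
  · refine hmono _ _ ?_
    rw [(hpar v hv).2, (hpar _ hpv).2]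
    omega
  · rcases h.diff_dist_adj (u := r) with hd | hd | hd
    · have hu : u ≠ r := by
        rintro rfl
        rw [SimpleGraph.dist_self] at hd
        exact huv (hconn.dist_eq_zero_iff.1 hd)
      exact Or.inr (Or.inr ⟨hu, hne.2 (hd ▸ hne.1 hu), hsib u v hu (Or.inr h) hd.symm,
        (hadj u v huv hd.symm).1 h⟩)
    · exact Or.inr (Or.inl (huniq u v h hd))
    · have hu : G.dist r u ≠ 0 := by
        intro h0
        have h0' : G.dist r v = 0 := by omega
        exact huv ((hconn.dist_eq_zero_iff.1 h0).symm.trans (hconn.dist_eq_zero_iff.1 h0'))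
      exact Or.inl (huniq v u h.symm (by omega))
  · rintro (⟨hu, rfl⟩ | ⟨hv, rfl⟩ | ⟨hu, hv, hp, ho⟩)
    · exact (hpar u hu).1.symm
    · exact (hpar v hv).1
    · refine (hadj u v huv ?_).2 ho
      rw [(hpar u hu).2, (hpar v hv).2, hp]

end

end EPG

theorem theorem2 {V : Type*} [Finite V] (G : SimpleGraph V)
    (hblock : ∀ B : G.Subgraph, EPG.IsBlock G B → EPG.IsLEPG B.coe)
    (hcut : ∀ v : V, EPG.IsCutVertex G v → ∀ B : G.Subgraph, EPG.IsBlock G B →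
      ∀ hv : v ∈ B.verts, EPG.IsUniversal B.coe ⟨v, hv⟩) :
    EPG.IsLEPG G := by
  refine (EPG.hasLRep_of_components G fun c => ?_).isLEPG
  have hG := (EPG.isBlockwiseLRep_of_blocks hblock hcut).induce_supp c
  by_cases h : ∃ r, EPG.IsCutVertex (G.induce c.supp) r
  · obtain ⟨r, hr⟩ := h
    exact hG.hasLRep_of_cutVertex c.connected_toSimpleGraph hr
  · exact hG.hasLRep_of_no_cutVertex c.connected_toSimpleGraph (not_exists.1 h)
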